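/- Let $\mathcal X,\mathcal Y\subset\mathbb R^d$ be compact, let $\rho$ and $\mu$ be Borel probability measures on $\mathbb R^d$ concentrated on $\mathcal X$ and $\mathcal Y$ respectively, and let $c\in C^1(\mathcal X\times\mathcal Y)$ be real-valued. Let $\Pi(\rho,\mu)$ be the set of couplings of $\rho$ and $\mu$, and call $\gamma\in\Pi(\rho,\mu)$ optimal if it minimises $\int c\,\mathrm d\gamma$ over $\Pi(\rho,\mu)$. A set $\Omega$ is called Lipschitz-path connected if any two points of $\Omega$ are joined by a Lipschitz curve $[0,1]\to\Omega$. Suppose that $\operatorname{supp}\rho=\bigcup_{i\in I}A_i$ and $\operatorname{supp}\mu=\bigcup_{j\in J}B_j$ with $I,J$ finite and all $A_i$, $B_j$ Lipschitz-path connected (for example, the connected components or the Lipschitz-path components of the supports, when these are finitely many and Lipschitz-path connected). Let $G$ be the bipartite graph with one vertex for each $A_i$ and one for each $B_j$, in which $A_i$ and $B_j$ are adjacent if and only if there is an optimal $\gamma\in\Pi(\rho,\mu)$ with $\gamma(A_i\times B_j)>0$ (outer measure, if $A_i\times B_j$ is not Borel). If $G$ is connected, then the solutions of the dual problem $$\max\Big\{\int\phi\,\mathrm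 d\rho+\int\psi\,\mathrm d\mu\ :\ \phi\in L^1(\rho),\ \psi\in L^1(\mu),\ \phi(x)+\psi(y)\le c(x,y)\ \text{ for all }(x,y)\in\mathcal X\times\mathcal Y\Big\}$$ are unique up to a constant: for any two maximisers $(\phi_0,\psi_0)$ and $(\phi_1,\psi_1)$ there is $a\in\mathbb R$ such that $\phi_1=\phi_0+a$ $\rho$-almost everywhere and $\psi_1=\psi_0-a$ $\mu$-almost everywhere. -/

import Mathlib

open MeasureTheory Set
open scoped NNReal

noncomputable section

namespace OTUniqueness

/-- `Ω` is Lipschitz-path connected: any two of its points are joined by a curve of finite length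
inside `Ω`, parametrised on `[0, 1]` so as to be Lipschitz. -/
def LipschitzPathConnected {E : Type*} [PseudoEMetricSpace E] (Ω : Set E) : Prop :=
  ∀ x₀ ∈ Ω, ∀ x₁ ∈ Ω, ∃ (ω : ℝ → E) (L : ℝ≥0),
    LipschitzOnWith L ω (Icc 0 1) ∧ MapsTo ω (Icc 0 1) Ω ∧ ω 0 = x₀ ∧ ω 1 = x₁

section Transport

variable {E F : Type*} [MeasurableSpace E] [MeasurableSpace F]

/-- `γ ∈ Π(ρ, μ)`: a measure on the product with marginals `ρ` and `μ`. For probability measures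
`ρ` and `μ` such a `γ` is a probability measure. -/
def IsPlan (ρ : Measure E) (μ : Measure F) (γ : Measure (E × F)) : Prop :=
  γ.map Prod.fst = ρ ∧ γ.map Prod.snd = μ

/-- `γ` minimises `∫ c dγ` over `Π(ρ, μ)`. -/
def IsOptimalPlan (c : E × F → ℝ) (ρ : Measure E) (μ : Measure F) (γ : Measure (E × F)) : Prop :=
  IsPlan ρ μ γ ∧ ∀ γ' : Measure (E × F), IsPlan ρ μ γ' → ∫ z, c z ∂γ ≤ ∫ z, c z ∂γ'

/-- `(φ, ψ)` is admissible for the dual problem: `φ ∈ L¹(ρ)`, `ψ ∈ L¹(μ)`, and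
`φ(x) + ψ(y) ≤ c(x, y)` for all `(x, y) ∈ X × Y`. -/
def DualAdmissible (X : Set E) (Y : Set F) (c : E × F → ℝ) (ρ : Measure E) (μ : Measure F)
    (φ : E → ℝ) (ψ : F → ℝ) : Prop :=
  Integrable φ ρ ∧ Integrable ψ μ ∧ ∀ x ∈ X, ∀ y ∈ Y, φ x + ψ y ≤ c (x, y)

/-- `(φ, ψ)` maximises `∫ φ dρ + ∫ ψ dμ` over all admissible pairs. -/
def IsDualOptimiser (X : Set E) (Y : Set F) (c : E × F → ℝ) (ρ : Measure E) (μ : Measure F)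
    (φ : E → ℝ) (ψ : F → ℝ) : Prop :=
  DualAdmissible X Y c ρ μ φ ψ ∧
    ∀ (φ' : E → ℝ) (ψ' : F → ℝ), DualAdmissible X Y c ρ μ φ' ψ' →
      ∫ x, φ' x ∂ρ + ∫ y, ψ' y ∂μ ≤ ∫ x, φ x ∂ρ + ∫ y, ψ y ∂μ

/-- The edge relation: some optimal plan charges `A × B`. -/
def Charged (c : E × F → ℝ) (ρ : Measure E) (μ : Measure F) (A : Set E) (B : Set F) : Prop :=
  ∃ γ : Measure (E × F), IsOptimalPlan c ρ μ γ ∧ 0 < γ (A ×ˢ B)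

/-- The bipartite graph with vertices `A i` (`i : I`) and `B j` (`j : J`), where `A i` and `B j`
are adjacent if and only if some optimal plan charges `A i × B j`. -/
def transportGraph (c : E × F → ℝ) (ρ : Measure E) (μ : Measure F) {I J : Type*}
    (A : I → Set E) (B : J → Set F) : SimpleGraph (I ⊕ J) where
  Adj u v :=
    (∃ i j, u = Sum.inl i ∧ v = Sum.inr j ∧ Charged c ρ μ (A i) (B j)) ∨
      (∃ i j, u = Sum.inr j ∧ v = Sum.inl i ∧ Charged c ρ μ (A i) (B j))
  symm := ⟨by
    rintro u v (⟨i, j, hu, hv, h⟩ | ⟨i, j, hu, hv, h⟩)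
    · exact Or.inr ⟨i, j, hv, hu, h⟩
    · exact Or.inl ⟨i, j, hv, hu, h⟩⟩
  loopless := ⟨by
    rintro u (⟨i, j, hu, hv, -⟩ | ⟨i, j, hu, hv, -⟩)
    · exact Sum.inl_ne_inr (hu.symm.trans hv)
    · exact Sum.inl_ne_inr (hv.symm.trans hu)⟩

end Transport

end OTUniqueness

end

/-! Passing to c-transforms changes a maximising pair only on null sets, so both maximisers may be
taken continuous and admissible. By Kantorovich duality (`exists_isPlan_integral_le`: Hahn–Banach
plus Riesz–Markov) some plan costs no more than the dual value. By complementary slackness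
(`IsPlan.ae_eq_of_integral_le`) that plan, and every optimal one, is concentrated on the compact set
K where both pairs touch c. The projections of K are closed and so contain the supports: every x in
supp ρ has a partner y at which both pairs are tight, and symmetrically.

The heart is `LipschitzPathConnected.sub_eq_sub`. Let ω be a Lipschitz curve in A_i and y a partner
of ω(t). Then c(ω(s), y) − φ_k(ω(s)) is minimal at s = t for k = 0, 1, so for almost every t both
φ_k ∘ ω have the derivative of c(ω(·), y) there. Both are Lipschitz, so φ₁ − φ₀ is constant on A_i;
likewise ψ₁ − ψ₀ on B_j. An optimal plan charging A_i × B_j forces this rectangle to meet K, where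
φ₁ − φ₀ = −(ψ₁ − ψ₀). Connectedness of the graph then makes all these constants agree. -/

open Filter Topology

namespace OTUniqueness

/-! ### Duality by Hahn–Banach -/

section Duality

variable {α β : Type*} [TopologicalSpace α] [CompactSpace α] [TopologicalSpace β] [CompactSpace β]

/-- The value of the relaxed dual problem: the infimum of `Λ φ + Λ' ψ` over all continuous pairs
with `φ ⊕ ψ ≥ f`. -/
noncomputable def dualUpperValue (Λ : C(α, ℝ) →ₗ[ℝ] ℝ) (Λ' : C(β, ℝ) →ₗ[ℝ] ℝ) (f : C(α × β, ℝ)) : ℝ :=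
  sInf {r | ∃ (φ : C(α, ℝ)) (ψ : C(β, ℝ)), (∀ z, f z ≤ φ z.1 + ψ z.2) ∧ Λ φ + Λ' ψ = r}

/-- A linear functional on `C(α × β)` with given marginals, which is positive and whose value at `c`
is at most any bound on the dual values. -/
theorem exists_linearMap_marginals (Λ : C(α, ℝ) →ₗ[ℝ] ℝ) (Λ' : C(β, ℝ) →ₗ[ℝ] ℝ)
    (hpos : ∀ (φ : C(α, ℝ)) (ψ : C(β, ℝ)), (∀ z : α × β, 0 ≤ φ z.1 + ψ z.2) → 0 ≤ Λ φ + Λ' ψ)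
    (h1 : Λ 1 = 1) (c : C(α × β, ℝ)) :
    ∃ g : C(α × β, ℝ) →ₗ[ℝ] ℝ, (∀ f, 0 ≤ f → 0 ≤ g f) ∧
      (∀ φ : C(α, ℝ), g (φ.comp ContinuousMap.fst) = Λ φ) ∧
      (∀ ψ : C(β, ℝ), g (ψ.comp ContinuousMap.snd) = Λ' ψ) ∧
      ∀ V : ℝ, (∀ (φ : C(α, ℝ)) (ψ : C(β, ℝ)), (∀ z : α × β, φ z.1 + ψ z.2 ≤ c z) →
        Λ φ + Λ' ψ ≤ V) → g c ≤ V := by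
  set p := dualUpperValue Λ Λ' with hp
  have hne (f : C(α × β, ℝ)) : {r | ∃ (φ : C(α, ℝ)) (ψ : C(β, ℝ)),
      (∀ z, f z ≤ φ z.1 + ψ z.2) ∧ Λ φ + Λ' ψ = r}.Nonempty :=
    ⟨_, ContinuousMap.const α ‖f‖, 0, fun z => by
      simpa using (le_abs_self _).trans (f.norm_coe_le_norm z), rfl⟩
  have hlow (f : C(α × β, ℝ)) (φ : C(α, ℝ)) (ψ : C(β, ℝ)) (h : ∀ z, f z ≤ φ z.1 + ψ z.2) :
      -‖f‖ ≤ Λ φ + Λ' ψ := by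
    have := hpos (φ + ‖f‖ • 1) ψ fun z => by
      have h2 := h z
      have h3 := (neg_le_abs _).trans (f.norm_coe_le_norm z)
      simp only [ContinuousMap.add_apply, ContinuousMap.smul_apply, ContinuousMap.one_apply,
        smul_eq_mul, mul_one]
      linarith
    rw [map_add, map_smul, h1, smul_eq_mul, mul_one] at this
    linarith
  have hbdd (f : C(α × β, ℝ)) : BddBelow {r | ∃ (φ : C(α, ℝ)) (ψ : C(β, ℝ)),
      (∀ z, f z ≤ φ z.1 + ψ z.2) ∧ Λ φ + Λ' ψ = r} :=
    ⟨-‖f‖, by rintro _ ⟨φ, ψ, h, rfl⟩; exact hlow f φ ψ h⟩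
  have hple {f : C(α × β, ℝ)} {φ : C(α, ℝ)} {ψ : C(β, ℝ)} (h : ∀ z, f z ≤ φ z.1 + ψ z.2) :
      p f ≤ Λ φ + Λ' ψ := csInf_le (hbdd f) ⟨φ, ψ, h, rfl⟩
  have hlep {f : C(α × β, ℝ)} {r : ℝ} (h : ∀ (φ : C(α, ℝ)) (ψ : C(β, ℝ)),
      (∀ z, f z ≤ φ z.1 + ψ z.2) → r ≤ Λ φ + Λ' ψ) : r ≤ p f :=
    le_csInf (hne f) (by rintro _ ⟨φ, ψ, h', rfl⟩; exact h φ ψ h')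
  have hadd (f f' : C(α × β, ℝ)) : p (f + f') ≤ p f + p f' := by
    rw [← sub_le_iff_le_add]
    refine hlep fun φ ψ h => ?_
    rw [sub_le_iff_le_add, ← sub_le_iff_le_add']
    refine hlep fun φ' ψ' h' => ?_
    have : p (f + f') ≤ Λ (φ + φ') + Λ' (ψ + ψ') := hple fun z => by
      have h1 := h z
      have h2 := h' z
      simp only [ContinuousMap.add_apply]
      linarith
    simp only [map_add] at this
    linarith
  have hsmul_le (a : ℝ) (ha : 0 < a) (f : C(α × β, ℝ)) : p (a • f) ≤ a * p f := by
    rw [← div_le_iff₀' ha]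
    refine hlep fun φ ψ h => ?_
    rw [div_le_iff₀' ha]
    have : p (a • f) ≤ Λ (a • φ) + Λ' (a • ψ) := hple fun z => by
      simpa [mul_add] using mul_le_mul_of_nonneg_left (h z) ha.le
    simpa [mul_add] using this
  have hsmul (a : ℝ) (ha : 0 < a) (f : C(α × β, ℝ)) : p (a • f) = a * p f := by
    refine le_antisymm (hsmul_le a ha f) ?_
    have := hsmul_le a⁻¹ (inv_pos.2 ha) (a • f)
    rwa [smul_smul, inv_mul_cancel₀ ha.ne', one_smul, ← div_eq_inv_mul, le_div_iff₀' ha] at this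
  have hp0 : p 0 = 0 := by
    refine le_antisymm ?_ (hlep fun φ ψ h => hpos φ ψ h)
    have : p 0 ≤ Λ 0 + Λ' 0 := hple fun z => by simp
    simpa using this
  -- The value −p(−c) is the least that a functional dominated by p can take at c, and it equals the
  -- supremum of Λ φ + Λ' ψ over φ ⊕ ψ ≤ c. Positivity and the marginals follow from g ≤ p alone,
  -- applied to a function and its negative.
  obtain ⟨g, hgc, hgp⟩ := exists_extension_of_le_sublinear
    (LinearPMap.mkSpanSingleton' (σ := RingHom.id ℝ) c (-p (-c)) (fun a ha => by
      rcases smul_eq_zero.1 ha with h | h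
      · simp [h]
      · simp [h, hp0])) p hsmul hadd (by
      rintro ⟨x, hx⟩
      obtain ⟨a, rfl⟩ := Submodule.mem_span_singleton.1 hx
      rw [LinearPMap.mkSpanSingleton'_apply, RingHom.id_apply, smul_eq_mul]
      change a * -p (-c) ≤ p (a • c)
      rcases lt_trichotomy a 0 with ha | rfl | ha
      · have := hsmul (-a) (neg_pos.2 ha) (-c)
        rw [smul_neg, neg_smul, neg_neg] at this
        rw [this]
        linarith
      · simp [hp0]
      · have h1 := hadd (a • c) (a • (-c))
        rw [smul_neg, add_neg_cancel, hp0, ← smul_neg, hsmul a ha (-c)] at h1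
        linarith)
  have hgc' : g c = -p (-c) := by
    have hm : c ∈ (LinearPMap.mkSpanSingleton' (σ := RingHom.id ℝ) c (-p (-c)) (fun a ha => by
      rcases smul_eq_zero.1 ha with h | h
      · simp [h]
      · simp [h, hp0])).domain := Submodule.mem_span_singleton_self c
    exact (hgc ⟨c, hm⟩).trans (LinearPMap.mkSpanSingleton'_apply_self _ _ _ _)
  have hfst_le (φ : C(α, ℝ)) : g (φ.comp ContinuousMap.fst) ≤ Λ φ := by
    refine (hgp _).trans ?_
    have : p (φ.comp ContinuousMap.fst) ≤ Λ φ + Λ' 0 := hple fun z => by simp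
    simpa using this
  have hsnd_le (ψ : C(β, ℝ)) : g (ψ.comp ContinuousMap.snd) ≤ Λ' ψ := by
    refine (hgp _).trans ?_
    have : p (ψ.comp ContinuousMap.snd) ≤ Λ 0 + Λ' ψ := hple fun z => by simp
    simpa using this
  refine ⟨g, fun f hf => ?_, fun φ => ?_, fun ψ => ?_, fun V hV => ?_⟩
  · have h1 : p (-f) ≤ Λ 0 + Λ' 0 := hple fun z => by simpa using hf z
    have h2 := hgp (-f)
    simp only [map_neg, map_zero, add_zero] at h1 h2
    linarith
  · refine le_antisymm (hfst_le φ) ?_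
    have h : g (-(φ.comp ContinuousMap.fst)) ≤ Λ (-φ) := hfst_le (-φ)
    simp only [map_neg] at h
    linarith
  · refine le_antisymm (hsnd_le ψ) ?_
    have h : g (-(ψ.comp ContinuousMap.snd)) ≤ Λ' (-ψ) := hsnd_le (-ψ)
    simp only [map_neg] at h
    linarith
  · rw [hgc', neg_le]
    refine hlep fun φ ψ h => ?_
    have := hV (-φ) (-ψ) fun z => by
      have := h z
      simp only [ContinuousMap.neg_apply] at this ⊢
      linarith
    simp only [map_neg] at this
    linarith

end Duality

/-! ### Differentiation along Lipschitz curves -/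

section Paths

variable {E F : Type*} [NormedAddCommGroup E] [NormedSpace ℝ E]
  [NormedAddCommGroup F] [NormedSpace ℝ F]

/-- A `C¹` function on a compact set has derivatives within that set that are uniformly bounded. -/
theorem exists_bound_hasFDerivWithinAt {K : Set E} (hK : IsCompact K) {c : E → F}
    (hc : ContDiffOn ℝ 1 c K) :
    ∃ M : ℝ, 0 ≤ M ∧ ∀ p ∈ K, ∃ c' : E →L[ℝ] F, HasFDerivWithinAt c c' K p ∧ ‖c'‖ ≤ M := by
  refine hK.induction_on (p := fun s => ∃ M : ℝ, 0 ≤ M ∧ ∀ p ∈ s, ∃ c' : E →L[ℝ] F,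
    HasFDerivWithinAt c c' K p ∧ ‖c'‖ ≤ M) ⟨0, le_rfl, by simp⟩ ?_ ?_ ?_
  · rintro s t hst ⟨M, hM, h⟩
    exact ⟨M, hM, fun p hp => h p (hst hp)⟩
  · rintro s t ⟨M, hM, h⟩ ⟨N, hN, h'⟩
    refine ⟨max M N, le_max_of_le_left hM, ?_⟩
    rintro p (hp | hp)
    · obtain ⟨c', h1, h2⟩ := h p hp
      exact ⟨c', h1, le_max_of_le_left h2⟩
    · obtain ⟨c', h1, h2⟩ := h' p hp
      exact ⟨c', h1, le_max_of_le_right h2⟩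
  · intro p hp
    have h := hc p hp
    -- K need not have unique derivatives, so the bound is sought for some local choice f' of
    -- derivatives within K that is continuous at p.
    rw [show (1 : WithTop ℕ∞) = 0 + 1 by simp,
      contDiffWithinAt_succ_iff_hasFDerivWithinAt' (by simp)] at h
    obtain ⟨u, hu, -, -, f', hf', hcf⟩ := h
    rw [insert_eq_of_mem hp] at hu
    have hcont : ContinuousWithinAt f' K p := hcf.continuousWithinAt
    have hb : ∀ᶠ q in 𝓝[K] p, ‖f' q‖ < ‖f' p‖ + 1 :=
      hcont.norm.eventually (gt_mem_nhds (lt_add_one _))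
    refine ⟨u ∩ {q | ‖f' q‖ < ‖f' p‖ + 1}, inter_mem hu hb, ‖f' p‖ + 1, by positivity, ?_⟩
    rintro q ⟨hq, hq'⟩
    exact ⟨f' q, hf' q hq, le_of_lt hq'⟩

/-- A function whose derivatives within `K` are bounded is Lipschitz along Lipschitz curves
in `K`. -/
theorem lipschitzOnWith_comp_curve {K : Set E} {c : E → F} {M L : ℝ≥0}
    (hc : ∀ p ∈ K, ∃ c' : E →L[ℝ] F, HasFDerivWithinAt c c' K p ∧ ‖c'‖ ≤ M)
    {ω : ℝ → E} (hω : LipschitzOnWith L ω (Icc 0 1)) (hK : MapsTo ω (Icc 0 1) K) :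
    LipschitzOnWith (M * L) (c ∘ ω) (Icc 0 1) := by
  have key : ∀ s ∈ Icc (0 : ℝ) 1, ∀ t ∈ Icc (0 : ℝ) 1, s ≤ t →
      ‖c (ω t) - c (ω s)‖ ≤ M * L * (t - s) := by
    intro s hs t ht hst
    have hsub : Icc s t ⊆ Icc (0 : ℝ) 1 := Icc_subset_Icc hs.1 ht.2
    have hcont : ContinuousOn (c ∘ ω) (Icc (0 : ℝ) 1) := by
      refine ContinuousOn.comp (t := K) (fun p hp => ?_) hω.continuousOn hK
      obtain ⟨c', h, -⟩ := hc p hp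
      exact h.continuousWithinAt
    -- K need not be convex, so the mean value inequality is applied along the curve; bounding right
    -- slopes avoids differentiating ω.
    refine image_le_of_liminf_slope_right_le_deriv_boundary
      (f := fun r => ‖c (ω r) - c (ω s)‖)
      (B := fun r => M * L * (r - s)) (B' := fun _ => M * L) (a := s) (b := t)
      ((hcont.mono hsub).sub continuousOn_const).norm (by simp) (by fun_prop) ?_ ?_
      (right_mem_Icc.2 hst)
    · intro x _
      simpa using (((hasDerivAt_id x).sub_const s).const_mul ((M : ℝ) * L)).hasDerivWithinAt
    · intro x hx r hr
      have hx1 : x ∈ Icc (0 : ℝ) 1 := hsub (Ico_subset_Icc_self hx)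
      obtain ⟨c', hc', hM⟩ := hc (ω x) (hK hx1)
      have hL : (0 : ℝ) < L + 1 := by positivity
      obtain ⟨ε, hε, hεr⟩ : ∃ ε : ℝ, 0 < ε ∧ (M + ε) * L < r := by
        -- Dividing by L + 1 rather than L covers L = 0.
        refine ⟨(r - M * L) / (L + 1), div_pos (sub_pos.2 hr) hL, ?_⟩
        have h1 : (r - M * L) / (L + 1) * (L + 1) = r - M * L := div_mul_cancel₀ _ hL.ne'
        have h2 : 0 < (r - M * L) / (L + 1) := div_pos (sub_pos.2 hr) hL
        linarith [h1, h2, mul_add ((r - M * L) / (L + 1)) (L : ℝ) 1]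
      have hcε : ∀ᶠ w in 𝓝[K] (ω x), ‖c w - c (ω x)‖ ≤ (M + ε) * ‖w - ω x‖ := by
        filter_upwards [hc'.isLittleO.def hε] with w hw
        have h1 : ‖c' (w - ω x)‖ ≤ M * ‖w - ω x‖ :=
          (c'.le_opNorm _).trans (mul_le_mul_of_nonneg_right hM (norm_nonneg _))
        have h2 := norm_sub_norm_le (c w - c (ω x)) (c' (w - ω x))
        linarith [add_mul (M : ℝ) ε ‖w - ω x‖]
      have hIoc : ∀ᶠ z in 𝓝[>] x, z ∈ Icc (0 : ℝ) 1 := by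
        filter_upwards [Ioo_mem_nhdsGT hx.2] with z hz
        exact hsub ⟨hx.1.trans hz.1.le, hz.2.le⟩
      have hle : 𝓝[>] x ≤ 𝓝[Icc 0 1] x := le_inf inf_le_left (le_principal_iff.2 hIoc)
      have hlim : Tendsto ω (𝓝[>] x) (𝓝[K] (ω x)) :=
        tendsto_nhdsWithin_iff.2 ⟨(hω.continuousOn x hx1).mono_left hle,
          hIoc.mono fun z hz => hK hz⟩
      refine Eventually.frequently ?_
      filter_upwards [hlim.eventually hcε, hIoc, self_mem_nhdsWithin] with z hz hz1 hxz
      have hxz : 0 < z - x := sub_pos.2 hxz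
      have h1 : ‖ω z - ω x‖ ≤ L * (z - x) := by
        have := hω.dist_le_mul z hz1 x hx1
        rwa [dist_eq_norm, Real.dist_eq, abs_of_pos hxz] at this
      have h2 : ‖c (ω z) - c (ω s)‖ - ‖c (ω x) - c (ω s)‖ ≤ ‖c (ω z) - c (ω x)‖ := by
        simpa using norm_sub_norm_le (c (ω z) - c (ω s)) (c (ω x) - c (ω s))
      have h3 : (M + ε) * ‖ω z - ω x‖ ≤ (M + ε) * (L * (z - x)) :=
        mul_le_mul_of_nonneg_left h1 (by positivity)
      rw [slope_def_field, div_lt_iff₀ hxz]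
      have h4 : (M + ε) * L * (z - x) < r * (z - x) := mul_lt_mul_of_pos_right hεr hxz
      linarith [mul_assoc ((M : ℝ) + ε) L (z - x)]
  refine LipschitzOnWith.of_dist_le_mul fun s hs t ht => ?_
  rcases le_total s t with h | h
  · rw [dist_comm, dist_comm s t, dist_eq_norm, Real.dist_eq, abs_of_nonneg (sub_nonneg.2 h)]
    exact_mod_cast key s hs t ht h
  · rw [dist_eq_norm, Real.dist_eq, abs_of_nonneg (sub_nonneg.2 h)]
    exact_mod_cast key t ht s hs h

/-- Two potentials that touch the cost at common contact points over a Lipschitz-path connected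
set `A` differ by a constant on `A`. -/
theorem LipschitzPathConnected.sub_eq_sub [FiniteDimensional ℝ E] {X A : Set E} {Y : Set F}
    (hA : LipschitzPathConnected A) (hAX : A ⊆ X) (hX : IsCompact X) (hY : IsCompact Y)
    {c : E × F → ℝ} (hc : ContDiffOn ℝ 1 c (X ×ˢ Y)) {φ₀ φ₁ : E → ℝ} {ψ₀ ψ₁ : F → ℝ}
    (h₀ : ∀ x ∈ X, ∀ y ∈ Y, φ₀ x + ψ₀ y ≤ c (x, y))
    (h₁ : ∀ x ∈ X, ∀ y ∈ Y, φ₁ x + ψ₁ y ≤ c (x, y))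
    (hcontact : ∀ x ∈ A, ∃ y ∈ Y, φ₀ x + ψ₀ y = c (x, y) ∧ φ₁ x + ψ₁ y = c (x, y))
    {x₀ x₁ : E} (hx₀ : x₀ ∈ A) (hx₁ : x₁ ∈ A) : φ₁ x₁ - φ₀ x₁ = φ₁ x₀ - φ₀ x₀ := by
  obtain ⟨ω, L, hω, hωA, rfl, rfl⟩ := hA x₀ hx₀ x₁ hx₁
  obtain ⟨M, hM0, hM⟩ := exists_bound_hasFDerivWithinAt (hX.prod hY) hc
  lift M to ℝ≥0 using hM0
  have hcurve (y : F) (hy : y ∈ Y) :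
      LipschitzOnWith (M * L) (fun t => c (ω t, y)) (Icc 0 1) := by
    have h : LipschitzOnWith L (fun t => (ω t, y)) (Icc 0 1) := by
      simpa using hω.prodMk (LipschitzWith.const y).lipschitzOnWith
    exact lipschitzOnWith_comp_curve hM h fun t ht => ⟨hAX (hωA ht), hy⟩
  have hlip {φ : E → ℝ} {ψ : F → ℝ} (h : ∀ x ∈ X, ∀ y ∈ Y, φ x + ψ y ≤ c (x, y))
      (hct : ∀ x ∈ A, ∃ y ∈ Y, φ x + ψ y = c (x, y)) :
      AbsolutelyContinuousOnInterval (φ ∘ ω) 0 1 := by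
    refine LipschitzOnWith.absolutelyContinuousOnInterval (K := M * L) ?_
    rw [uIcc_of_le zero_le_one]
    refine LipschitzOnWith.of_le_add_mul _ fun s hs t ht => ?_
    -- With y tight at ω t, ψ y cancels and φ (ω s) − φ (ω t) ≤ c (ω s, y) − c (ω t, y); the
    -- constant M * L serves every y.
    obtain ⟨y, hy, hty⟩ := hct (ω t) (hωA ht)
    have h1 := h (ω s) (hAX (hωA hs)) y hy
    have h2 := (le_abs_self _).trans ((hcurve y hy).dist_le_mul s hs t ht)
    simp only [Function.comp_apply]
    linarith
  have hac₀ := hlip h₀ fun x hx => (hcontact x hx).imp fun y hy => ⟨hy.1, hy.2.1⟩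
  have hac₁ := hlip h₁ fun x hx => (hcontact x hx).imp fun y hy => ⟨hy.1, hy.2.2⟩
  have hderiv : ∀ᵐ t, t ∈ uIoc (0 : ℝ) 1 → deriv (φ₁ ∘ ω - φ₀ ∘ ω) t = 0 := by
    -- The endpoint is dropped so that `Icc 0 1` is a neighbourhood of t, which an interior minimum
    -- requires.
    have hne : ∀ᵐ t : ℝ, t ≠ 1 := Measure.ae_ne volume 1
    filter_upwards [hac₀.ae_differentiableAt, hac₁.ae_differentiableAt,
      hω.ae_differentiableWithinAt_of_mem, hne] with t d₀ d₁ dω ht1 ht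
    have htI := uIoc_subset_uIcc ht
    specialize d₀ htI
    specialize d₁ htI
    rw [uIcc_of_le zero_le_one] at htI
    rw [uIoc_of_le zero_le_one] at ht
    have hnhds : Icc (0 : ℝ) 1 ∈ 𝓝 t := Icc_mem_nhds ht.1 (lt_of_le_of_ne ht.2 ht1)
    obtain ⟨y, hy, e₀, e₁⟩ := hcontact (ω t) (hωA htI)
    obtain ⟨c', hc', -⟩ := hM (ω t, y) ⟨hAX (hωA htI), hy⟩
    have hg : DifferentiableAt ℝ (fun s => c (ω s, y)) t := by
      have hω' : DifferentiableWithinAt ℝ (fun s => (ω s, y)) (Icc 0 1) t :=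
        (dω htI).prodMk (differentiableWithinAt_const y)
      exact (DifferentiableWithinAt.comp t (g := c) (t := X ×ˢ Y) hc'.differentiableWithinAt hω'
        fun s hs => ⟨hAX (hωA hs), hy⟩).differentiableAt hnhds
    have hd {φ : E → ℝ} {ψ : F → ℝ} (h : ∀ x ∈ X, ∀ y ∈ Y, φ x + ψ y ≤ c (x, y))
        (e : φ (ω t) + ψ y = c (ω t, y)) (d : DifferentiableAt ℝ (φ ∘ ω) t) :
        deriv (fun s => c (ω s, y)) t - deriv (φ ∘ ω) t = 0 := by
      refine IsLocalMin.hasDerivAt_eq_zero (f := (fun s => c (ω s, y)) - φ ∘ ω) ?_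
        (hg.hasDerivAt.sub d.hasDerivAt)
      filter_upwards [hnhds] with s hs
      have := h (ω s) (hAX (hωA hs)) y hy
      simp only [Pi.sub_apply, Function.comp_apply]
      linarith
    rw [deriv_sub d₁ d₀]
    linarith [hd h₀ e₀ d₀, hd h₁ e₁ d₁]
  have hint := (hac₁.sub hac₀).integral_deriv_eq_sub
  rw [intervalIntegral.integral_congr_ae (g := fun _ => 0) hderiv] at hint
  simp only [intervalIntegral.integral_zero, Pi.sub_apply, Function.comp_apply] at hint
  linarith

end Paths

/-! ### Existence of a plan attaining the dual bound -/

section Plans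

/-- On a compact product there is a plan whose cost is at most any bound on the dual values. -/
theorem exists_isPlan_of_compactSpace {α β : Type*} [MetricSpace α] [CompactSpace α]
    [MeasurableSpace α] [BorelSpace α] [MetricSpace β] [CompactSpace β]
    [MeasurableSpace β] [BorelSpace β] (ρ : Measure α) (μ : Measure β) [IsProbabilityMeasure ρ]
    [IsProbabilityMeasure μ] (c : C(α × β, ℝ)) :
    ∃ γ : Measure (α × β), IsPlan ρ μ γ ∧
      ∀ V : ℝ, (∀ (φ : C(α, ℝ)) (ψ : C(β, ℝ)), (∀ z : α × β, φ z.1 + ψ z.2 ≤ c z) →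
        ∫ x, φ x ∂ρ + ∫ y, ψ y ∂μ ≤ V) → ∫ z, c z ∂γ ≤ V := by
  have hintα (φ : C(α, ℝ)) : Integrable φ ρ :=
    φ.continuous.integrable_of_hasCompactSupport (HasCompactSupport.of_compactSpace _)
  have hintβ (ψ : C(β, ℝ)) : Integrable ψ μ :=
    ψ.continuous.integrable_of_hasCompactSupport (HasCompactSupport.of_compactSpace _)
  let Λ : C(α, ℝ) →ₗ[ℝ] ℝ :=
    { toFun := fun φ => ∫ x, φ x ∂ρ
      map_add' := fun φ φ' => integral_add (hintα φ) (hintα φ')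
      map_smul' := fun a φ => integral_const_mul a _ }
  let Λ' : C(β, ℝ) →ₗ[ℝ] ℝ :=
    { toFun := fun ψ => ∫ y, ψ y ∂μ
      map_add' := fun ψ ψ' => integral_add (hintβ ψ) (hintβ ψ')
      map_smul' := fun a ψ => integral_const_mul a _ }
  have hpos (φ : C(α, ℝ)) (ψ : C(β, ℝ)) (h : ∀ z : α × β, 0 ≤ φ z.1 + ψ z.2) :
      0 ≤ Λ φ + Λ' ψ := by
    -- Integrating φ(x) + ψ(y) first in x, then in y.
    have h1 (y : β) : 0 ≤ Λ φ + ψ y := by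
      have h2 : 0 ≤ ∫ x, (φ x + ψ y) ∂ρ := integral_nonneg fun x => h (x, y)
      rw [integral_add (hintα φ) (integrable_const _)] at h2
      simpa [Λ] using h2
    have h2 : 0 ≤ ∫ y, (Λ φ + ψ y) ∂μ := integral_nonneg h1
    rw [integral_add (integrable_const _) (hintβ ψ)] at h2
    simpa [Λ'] using h2
  obtain ⟨g, hg, hg₁, hg₂, hgV⟩ :=
    exists_linearMap_marginals Λ Λ' hpos (by simp [Λ]) c
  let G : CompactlySupportedContinuousMap (α × β) ℝ →ₚ[ℝ] ℝ := PositiveLinearMap.mk₀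
    { toFun := fun f => g f.toContinuousMap
      map_add' := fun f f' => map_add g f.toContinuousMap f'.toContinuousMap
      map_smul' := fun a f => map_smul g a f.toContinuousMap }
    (fun f hf => hg _ fun z => hf z)
  set γ := RealRMK.rieszMeasure G
  have hγ (f : C(α × β, ℝ)) : ∫ z, f z ∂γ = g f :=
    RealRMK.integral_rieszMeasure G (CompactlySupportedContinuousMap.continuousMapEquiv f)
  have : IsFiniteMeasure γ := inferInstance
  refine ⟨γ, ⟨?_, ?_⟩, fun V hV => ?_⟩
  · refine ext_of_forall_integral_eq_of_IsFiniteMeasure fun f => ?_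
    rw [integral_map measurable_fst.aemeasurable
      f.continuous.measurable.aestronglyMeasurable]
    exact (hγ (f.toContinuousMap.comp ContinuousMap.fst)).trans (hg₁ f.toContinuousMap)
  · refine ext_of_forall_integral_eq_of_IsFiniteMeasure fun f => ?_
    rw [integral_map measurable_snd.aemeasurable
      f.continuous.measurable.aestronglyMeasurable]
    exact (hγ (f.toContinuousMap.comp ContinuousMap.snd)).trans (hg₂ f.toContinuousMap)
  · rw [hγ]
    exact hgV V hV

variable {E F : Type*} [MetricSpace E] [MeasurableSpace E] [BorelSpace E] [MetricSpace F]
  [MeasurableSpace F] [BorelSpace F]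

/-- Compact Kantorovich duality: some plan costs no more than the value of any dual optimiser. -/
theorem exists_isPlan_integral_le {X : Set E} {Y : Set F} (hX : IsCompact X) (hY : IsCompact Y)
    {ρ : Measure E} {μ : Measure F} [IsProbabilityMeasure ρ] [IsProbabilityMeasure μ]
    (hρX : ρ Xᶜ = 0) (hμY : μ Yᶜ = 0) {c : E × F → ℝ} (hc : ContinuousOn c (X ×ˢ Y)) :
    ∃ γ : Measure (E × F), IsPlan ρ μ γ ∧ ∀ (φ : E → ℝ) (ψ : F → ℝ),
      IsDualOptimiser X Y c ρ μ φ ψ → ∫ z, c z ∂γ ≤ ∫ x, φ x ∂ρ + ∫ y, ψ y ∂μ := by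
  have : CompactSpace X := isCompact_iff_compactSpace.1 hX
  have : CompactSpace Y := isCompact_iff_compactSpace.1 hY
  have eX : MeasurableEmbedding (Subtype.val : X → E) :=
    MeasurableEmbedding.subtype_coe hX.measurableSet
  have eY : MeasurableEmbedding (Subtype.val : Y → F) :=
    MeasurableEmbedding.subtype_coe hY.measurableSet
  set ρ' : Measure X := ρ.comap Subtype.val
  set μ' : Measure Y := μ.comap Subtype.val
  have hρ' : ρ'.map Subtype.val = ρ := by
    rw [eX.map_comap, Subtype.range_coe]
    exact Measure.restrict_eq_self_of_ae_mem hρX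
  have hμ' : μ'.map Subtype.val = μ := by
    rw [eY.map_comap, Subtype.range_coe]
    exact Measure.restrict_eq_self_of_ae_mem hμY
  have : IsProbabilityMeasure ρ' := by
    have : IsProbabilityMeasure (ρ'.map Subtype.val) := by rwa [hρ']
    exact (Measure.isProbabilityMeasure_map_iff eX.measurable.aemeasurable).1 this
  have : IsProbabilityMeasure μ' := by
    have : IsProbabilityMeasure (μ'.map Subtype.val) := by rwa [hμ']
    exact (Measure.isProbabilityMeasure_map_iff eY.measurable.aemeasurable).1 this
  have hpair : Continuous fun z : X × Y => ((z.1 : E), (z.2 : F)) := by fun_prop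
  have hcc : Continuous fun z : X × Y => c ((z.1 : E), (z.2 : F)) :=
    hc.comp_continuous hpair fun z => ⟨z.1.2, z.2.2⟩
  obtain ⟨γ, ⟨h1, h2⟩, hγ⟩ := exists_isPlan_of_compactSpace ρ' μ' ⟨_, hcc⟩
  have ePair : MeasurableEmbedding fun z : X × Y => ((z.1 : E), (z.2 : F)) := eX.prodMap eY
  refine ⟨γ.map fun z => ((z.1 : E), (z.2 : F)), ⟨?_, ?_⟩, fun φ ψ h => ?_⟩
  · rw [Measure.map_map measurable_fst ePair.measurable, ← hρ', ← h1,
      Measure.map_map eX.measurable measurable_fst]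
    rfl
  · rw [Measure.map_map measurable_snd ePair.measurable, ← hμ', ← h2,
      Measure.map_map eY.measurable measurable_snd]
    rfl
  · rw [ePair.integral_map]
    refine hγ _ fun f g hfg => ?_
    have hf : (Function.extend Subtype.val f 0 : E → ℝ) ∘ Subtype.val = f :=
      Function.extend_comp eX.injective _ _
    have hg : (Function.extend Subtype.val g 0 : F → ℝ) ∘ Subtype.val = g :=
      Function.extend_comp eY.injective _ _
    -- Admissibility constrains only X × Y, so extension by zero turns continuous pairs on the
    -- subtypes into competitors of the optimiser.
    have key := h.2 (Function.extend Subtype.val f 0) (Function.extend Subtype.val g 0) ⟨?_, ?_, ?_⟩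
    · have e₁ : ∫ x, Function.extend Subtype.val f 0 x ∂ρ = ∫ x, f x ∂ρ' := by
        rw [← hρ', eX.integral_map]
        exact congrArg (fun k => ∫ x, k x ∂ρ') hf
      have e₂ : ∫ y, Function.extend Subtype.val g 0 y ∂μ = ∫ y, g y ∂μ' := by
        rw [← hμ', eY.integral_map]
        exact congrArg (fun k => ∫ y, k y ∂μ') hg
      rwa [e₁, e₂] at key
    · rw [← hρ', eX.integrable_map_iff, hf]
      exact f.continuous.integrable_of_hasCompactSupport (HasCompactSupport.of_compactSpace _)
    · rw [← hμ', eY.integrable_map_iff, hg]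
      exact g.continuous.integrable_of_hasCompactSupport (HasCompactSupport.of_compactSpace _)
    · intro x hx y hy
      have := hfg (⟨x, hx⟩, ⟨y, hy⟩)
      rwa [← congrFun hf ⟨x, hx⟩, ← congrFun hg ⟨y, hy⟩] at this

end Plans

/-! ### Regularisation by c-transforms -/

section Transform

variable {E F : Type*} [MetricSpace E] [MetricSpace F]

/-- The `c`-transform of `ψ` is the largest, and a continuous, potential admissible with `ψ`. -/
theorem exists_continuousOn_le_of_admissible {X : Set E} {Y : Set F} (hX : IsCompact X)
    (hY : IsCompact Y) (hYne : Y.Nonempty) {c : E × F → ℝ} (hc : ContinuousOn c (X ×ˢ Y))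
    {φ : E → ℝ} {ψ : F → ℝ} (h : ∀ x ∈ X, ∀ y ∈ Y, φ x + ψ y ≤ c (x, y)) :
    ∃ φ' : E → ℝ, ContinuousOn φ' X ∧ (∀ x ∈ X, φ x ≤ φ' x) ∧
      ∀ x ∈ X, ∀ y ∈ Y, φ' x + ψ y ≤ c (x, y) := by
  set φ' : E → ℝ := fun x => sInf ((fun y => c (x, y) - ψ y) '' Y)
  have hne (x : E) : ((fun y => c (x, y) - ψ y) '' Y).Nonempty := hYne.image _
  have hle (x : E) (hx : x ∈ X) (y : F) (hy : y ∈ Y) : φ' x ≤ c (x, y) - ψ y := by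
    refine csInf_le ⟨φ x, ?_⟩ (mem_image_of_mem _ hy)
    rintro _ ⟨y', hy', rfl⟩
    linarith [h x hx y' hy']
  have hge (x : E) (r : ℝ) (hr : ∀ y ∈ Y, r ≤ c (x, y) - ψ y) : r ≤ φ' x :=
    le_csInf (hne x) (by rintro _ ⟨y, hy, rfl⟩; exact hr y hy)
  refine ⟨φ', ?_, fun x hx => hge x _ fun y hy => by linarith [h x hx y hy],
    fun x hx y hy => by linarith [hle x hx y hy]⟩
  -- The functions c(·, y) − ψ(y) share one modulus of continuity, which their infimum inherits.
  have huc := Metric.uniformContinuousOn_iff.1 ((hX.prod hY).uniformContinuousOn_of_continuous hc)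
  refine Metric.continuousOn_iff.2 fun b hb ε hε => ?_
  obtain ⟨δ, hδ, hδc⟩ := huc (ε / 2) (half_pos hε)
  have key (a : E) (ha : a ∈ X) (b : E) (hb : b ∈ X) (hab : dist a b < δ) :
      φ' a - ε / 2 ≤ φ' b := by
    refine hge b _ fun y hy => ?_
    have h1 := hδc (a, y) ⟨ha, hy⟩ (b, y) ⟨hb, hy⟩ (by
      rw [dist_prod_same_right]
      exact hab)
    rw [Real.dist_eq] at h1
    linarith [(abs_lt.1 h1).2, hle a ha y hy]
  refine ⟨δ, hδ, fun a ha hab => ?_⟩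
  have h1 := key a ha b hb hab
  have h2 := key b hb a ha (by rwa [dist_comm])
  rw [Real.dist_eq, abs_lt]
  constructor <;> linarith

/-- An admissible pair is dominated by an admissible pair of continuous potentials. -/
theorem exists_continuousOn_pair_le_of_admissible {X : Set E} {Y : Set F} (hX : IsCompact X)
    (hY : IsCompact Y) (hXne : X.Nonempty) (hYne : Y.Nonempty) {c : E × F → ℝ}
    (hc : ContinuousOn c (X ×ˢ Y)) {φ : E → ℝ} {ψ : F → ℝ}
    (h : ∀ x ∈ X, ∀ y ∈ Y, φ x + ψ y ≤ c (x, y)) :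
    ∃ (φ' : E → ℝ) (ψ' : F → ℝ), ContinuousOn φ' X ∧ ContinuousOn ψ' Y ∧
      (∀ x ∈ X, φ x ≤ φ' x) ∧ (∀ y ∈ Y, ψ y ≤ ψ' y) ∧
      ∀ x ∈ X, ∀ y ∈ Y, φ' x + ψ' y ≤ c (x, y) := by
  obtain ⟨φ', hφ', hle, hadm⟩ := exists_continuousOn_le_of_admissible hX hY hYne hc h
  have hc' : ContinuousOn (c ∘ Prod.swap) (Y ×ˢ X) :=
    hc.comp continuous_swap.continuousOn fun z hz => ⟨hz.2, hz.1⟩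
  obtain ⟨ψ', hψ', hle', hadm'⟩ := exists_continuousOn_le_of_admissible hY hX hXne hc'
    (φ := ψ) (ψ := φ') fun y hy x hx => by
      simpa [add_comm] using hadm x hx y hy
  exact ⟨φ', ψ', hφ', hψ', hle, hle', fun x hx y hy => by
    simpa [add_comm] using hadm' y hy x hx⟩

end Transform

/-! ### Complementary slackness and supports -/

section Contact

theorem integrable_of_continuousOn_isCompact {E : Type*} [TopologicalSpace E] [T2Space E]
    [TopologicalSpace.PseudoMetrizableSpace E]
    [MeasurableSpace E] [BorelSpace E] {ρ : Measure E} [IsFiniteMeasure ρ] {X : Set E}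
    (hX : IsCompact X) (hρX : ρ Xᶜ = 0) {f : E → ℝ} (hf : ContinuousOn f X) : Integrable f ρ := by
  have h := hf.integrableOn_compact (μ := ρ) hX
  rwa [IntegrableOn, Measure.restrict_eq_self_of_ae_mem hρX] at h

/-- A plan is concentrated on `X × Y` when its marginals are concentrated on `X` and `Y`. -/
theorem IsPlan.ae_mem_prod {E F : Type*} [MeasurableSpace E] [MeasurableSpace F]
    {ρ : Measure E} {μ : Measure F} {X : Set E} {Y : Set F} {γ : Measure (E × F)} (hγ : IsPlan ρ μ γ)
    (hρX : ∀ᵐ x ∂ρ, x ∈ X)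
    (hμY : ∀ᵐ y ∂μ, y ∈ Y) : ∀ᵐ z ∂γ, z ∈ X ×ˢ Y := by
  rw [← hγ.1] at hρX
  rw [← hγ.2] at hμY
  filter_upwards [ae_of_ae_map measurable_fst.aemeasurable hρX,
    ae_of_ae_map measurable_snd.aemeasurable hμY] with z h1 h2
  exact ⟨h1, h2⟩

variable {E F : Type*} [MetricSpace E] [MeasurableSpace E] [BorelSpace E] [MetricSpace F]
  [MeasurableSpace F] [BorelSpace F]
  {X : Set E} {Y : Set F} {ρ : Measure E} {μ : Measure F} {c : E × F → ℝ}

/-- A dual optimiser agrees almost everywhere with a continuous admissible pair. -/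
theorem IsDualOptimiser.exists_continuousOn [IsProbabilityMeasure ρ] [IsProbabilityMeasure μ]
    {φ : E → ℝ} {ψ : F → ℝ} (h : IsDualOptimiser X Y c ρ μ φ ψ) (hX : IsCompact X)
    (hY : IsCompact Y) (hρX : ρ Xᶜ = 0) (hμY : μ Yᶜ = 0) (hc : ContinuousOn c (X ×ˢ Y)) :
    ∃ (φ' : E → ℝ) (ψ' : F → ℝ), ContinuousOn φ' X ∧ ContinuousOn ψ' Y ∧
      φ =ᵐ[ρ] φ' ∧ ψ =ᵐ[μ] ψ' ∧ ∀ x ∈ X, ∀ y ∈ Y, φ' x + ψ' y ≤ c (x, y) := by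
  have hXae : ∀ᵐ x ∂ρ, x ∈ X := hρX
  have hYae : ∀ᵐ y ∂μ, y ∈ Y := hμY
  obtain ⟨φ', ψ', hφ', hψ', hle, hle', hadm⟩ :=
    exists_continuousOn_pair_le_of_admissible hX hY hXae.exists hYae.exists hc h.1.2.2
  have iφ' := integrable_of_continuousOn_isCompact hX hρX hφ'
  have iψ' := integrable_of_continuousOn_isCompact hY hμY hψ'
  have lφ : φ ≤ᵐ[ρ] φ' := hXae.mono hle
  have lψ : ψ ≤ᵐ[μ] ψ' := hYae.mono hle'
  have h1 := integral_mono_ae h.1.1 iφ' lφ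
  have h2 := integral_mono_ae h.1.2.1 iψ' lψ
  -- Optimality against a dominating pair forces both integrals to be equal, hence equality almost
  -- everywhere.
  have h3 := h.2 φ' ψ' ⟨iφ', iψ', hadm⟩
  exact ⟨φ', ψ', hφ', hψ',
    (integral_eq_iff_of_ae_le h.1.1 iφ' lφ).1 (by linarith),
    (integral_eq_iff_of_ae_le h.1.2.1 iψ' lψ).1 (by linarith), hadm⟩

/-- Complementary slackness: a plan costing no more than the value of an admissible pair is
concentrated on the set where the pair touches the cost. -/
theorem IsPlan.ae_eq_of_integral_le [SecondCountableTopology E] [IsProbabilityMeasure ρ]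
    [IsProbabilityMeasure μ]
    {γ : Measure (E × F)} (hγ : IsPlan ρ μ γ) (hX : IsCompact X)
    (hY : IsCompact Y) (hρX : ρ Xᶜ = 0) (hμY : μ Yᶜ = 0) (hc : ContinuousOn c (X ×ˢ Y))
    {φ : E → ℝ} {ψ : F → ℝ} (hφ : Integrable φ ρ) (hψ : Integrable ψ μ)
    (h : ∀ x ∈ X, ∀ y ∈ Y, φ x + ψ y ≤ c (x, y))
    (hle : ∫ z, c z ∂γ ≤ ∫ x, φ x ∂ρ + ∫ y, ψ y ∂μ) : ∀ᵐ z ∂γ, φ z.1 + ψ z.2 = c z := by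
  have hae := hγ.ae_mem_prod (X := X) (Y := Y) hρX hμY
  have : IsProbabilityMeasure γ := by
    have : IsProbabilityMeasure (γ.map Prod.fst) := by rwa [hγ.1]
    exact (Measure.isProbabilityMeasure_map_iff measurable_fst.aemeasurable).1 this
  have ic : Integrable c γ := integrable_of_continuousOn_isCompact (hX.prod hY) hae hc
  rw [← hγ.1] at hφ
  rw [← hγ.2] at hψ
  have iφ : Integrable (fun z : E × F => φ z.1) γ := hφ.comp_measurable measurable_fst
  have iψ : Integrable (fun z : E × F => ψ z.2) γ := hψ.comp_measurable measurable_snd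
  have h1 : ∫ x, φ x ∂ρ = ∫ z, φ z.1 ∂γ := by
    rw [← integral_map measurable_fst.aemeasurable hφ.aestronglyMeasurable, hγ.1]
  have h2 : ∫ y, ψ y ∂μ = ∫ z, ψ z.2 ∂γ := by
    rw [← integral_map measurable_snd.aemeasurable hψ.aestronglyMeasurable, hγ.2]
  have hl : (fun z : E × F => φ z.1 + ψ z.2) ≤ᵐ[γ] c := hae.mono fun z hz => h z.1 hz.1 z.2 hz.2
  refine (integral_eq_iff_of_ae_le (iφ.add iψ) ic hl).1 (le_antisymm
    (integral_mono_ae (iφ.add iψ) ic hl) ?_)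
  refine hle.trans_eq ?_
  rw [h1, h2]
  exact (integral_add iφ iψ).symm

/-- If a plan is concentrated on a compact set, then that set projects onto the supports of the
marginals. -/
theorem IsPlan.support_subset_image {γ : Measure (E × F)} (hγ : IsPlan ρ μ γ) {K : Set (E × F)}
    (hK : IsCompact K) (h : ∀ᵐ z ∂γ, z ∈ K) :
    ρ.support ⊆ Prod.fst '' K ∧ μ.support ⊆ Prod.snd '' K := by
  constructor
  · have hcl : IsClosed (Prod.fst '' K) := (hK.image continuous_fst).isClosed
    refine Measure.support_subset_of_isClosed hcl ?_
    rw [← hγ.1]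
    exact (ae_map_iff measurable_fst.aemeasurable hcl.measurableSet).2
      (h.mono fun z hz => mem_image_of_mem _ hz)
  · have hcl : IsClosed (Prod.snd '' K) := (hK.image continuous_snd).isClosed
    refine Measure.support_subset_of_isClosed hcl ?_
    rw [← hγ.2]
    exact (ae_map_iff measurable_snd.aemeasurable hcl.measurableSet).2
      (h.mono fun z hz => mem_image_of_mem _ hz)

end Contact

/-! ### Contact set and propagation through the graph -/

section Uniqueness

/-- The set of points of `X × Y` at which both pairs of potentials touch the cost. -/
def contactSet {E F : Type*} (X : Set E) (Y : Set F) (c : E × F → ℝ) (φ₀ : E → ℝ) (ψ₀ : F → ℝ)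
    (φ₁ : E → ℝ) (ψ₁ : F → ℝ) : Set (E × F) :=
  {z ∈ X ×ˢ Y | φ₀ z.1 + ψ₀ z.2 = c z ∧ φ₁ z.1 + ψ₁ z.2 = c z}

/-- Compactness makes both projections of the contact set closed, so that full measure upgrades to
containing every point of the supports. -/
theorem isCompact_contactSet {E F : Type*} [MetricSpace E] [MetricSpace F] {X : Set E} {Y : Set F}
    (hX : IsCompact X) (hY : IsCompact Y) {c : E × F → ℝ} (hc : ContinuousOn c (X ×ˢ Y))
    {φ₀ φ₁ : E → ℝ} {ψ₀ ψ₁ : F → ℝ} (hφ₀ : ContinuousOn φ₀ X) (hφ₁ : ContinuousOn φ₁ X)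
    (hψ₀ : ContinuousOn ψ₀ Y) (hψ₁ : ContinuousOn ψ₁ Y) :
    IsCompact (contactSet X Y c φ₀ ψ₀ φ₁ ψ₁) := by
  have hcl := (hX.prod hY).isClosed
  have key {φ : E → ℝ} {ψ : F → ℝ} (hφ : ContinuousOn φ X) (hψ : ContinuousOn ψ Y) :
      ContinuousOn (fun z : E × F => φ z.1 + ψ z.2 - c z) (X ×ˢ Y) :=
    ((hφ.comp continuousOn_fst fun z hz => hz.1).add
      (hψ.comp continuousOn_snd fun z hz => hz.2)).sub hc
  have h₀ := (key hφ₀ hψ₀).preimage_isClosed_of_isClosed hcl (isClosed_singleton (x := 0))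
  have h₁ := (key hφ₁ hψ₁).preimage_isClosed_of_isClosed hcl (isClosed_singleton (x := 0))
  refine (hX.prod hY).of_isClosed_subset ?_ (sep_subset _ _)
  convert h₀.inter h₁ using 1
  ext z
  simp only [contactSet, mem_ofPred_eq, mem_inter_iff, mem_preimage, mem_singleton_iff, sub_eq_zero]
  tauto

variable {E F : Type*} [NormedAddCommGroup E] [NormedSpace ℝ E] [FiniteDimensional ℝ E]
  [MeasurableSpace E] [BorelSpace E] [NormedAddCommGroup F] [NormedSpace ℝ F]
  [FiniteDimensional ℝ F] [MeasurableSpace F] [BorelSpace F]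

/-- Uniqueness of dual optimisers up to a constant when the transport graph is connected. -/
theorem exists_ae_eq_add_of_connected {X : Set E} {Y : Set F} (hX : IsCompact X) (hY : IsCompact Y)
    {ρ : Measure E} {μ : Measure F} [IsProbabilityMeasure ρ] [IsProbabilityMeasure μ]
    (hρX : ρ Xᶜ = 0) (hμY : μ Yᶜ = 0) {c : E × F → ℝ} (hc : ContDiffOn ℝ 1 c (X ×ˢ Y))
    {I J : Type*} {A : I → Set E} {B : J → Set F}
    (hA : ∀ i, LipschitzPathConnected (A i)) (hB : ∀ j, LipschitzPathConnected (B j))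
    (hρA : ρ.support = ⋃ i, A i) (hμB : μ.support = ⋃ j, B j)
    (hG : (transportGraph c ρ μ A B).Connected) {φ₀ φ₁ : E → ℝ} {ψ₀ ψ₁ : F → ℝ}
    (h₀ : IsDualOptimiser X Y c ρ μ φ₀ ψ₀) (h₁ : IsDualOptimiser X Y c ρ μ φ₁ ψ₁) :
    ∃ a : ℝ, (∀ᵐ x ∂ρ, φ₁ x = φ₀ x + a) ∧ (∀ᵐ y ∂μ, ψ₁ y = ψ₀ y - a) := by
  have : ProperSpace E := FiniteDimensional.proper_real E
  have : ProperSpace F := FiniteDimensional.proper_real F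
  have hcc : ContinuousOn c (X ×ˢ Y) := hc.continuousOn
  obtain ⟨γ, hγ, hγle⟩ := exists_isPlan_integral_le hX hY hρX hμY hcc
  obtain ⟨f₀, g₀, hf₀, hg₀, ef₀, eg₀, hadm₀⟩ := h₀.exists_continuousOn hX hY hρX hμY hcc
  obtain ⟨f₁, g₁, hf₁, hg₁, ef₁, eg₁, hadm₁⟩ := h₁.exists_continuousOn hX hY hρX hμY hcc
  set K := contactSet X Y c f₀ g₀ f₁ g₁
  have hK : IsCompact K := isCompact_contactSet hX hY hcc hf₀ hf₁ hg₀ hg₁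
  have hconc {γ' : Measure (E × F)} (hγ' : IsPlan ρ μ γ') (hle : ∫ z, c z ∂γ' ≤ ∫ z, c z ∂γ) :
      ∀ᵐ z ∂γ', z ∈ K := by
    have h0 := hle.trans (hγle _ _ h₀)
    have h1 := hle.trans (hγle _ _ h₁)
    rw [integral_congr_ae ef₀, integral_congr_ae eg₀] at h0
    rw [integral_congr_ae ef₁, integral_congr_ae eg₁] at h1
    filter_upwards [hγ'.ae_mem_prod (X := X) (Y := Y) hρX hμY,
      hγ'.ae_eq_of_integral_le hX hY hρX hμY hcc (h₀.1.1.congr ef₀) (h₀.1.2.1.congr eg₀) hadm₀ h0,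
      hγ'.ae_eq_of_integral_le hX hY hρX hμY hcc (h₁.1.1.congr ef₁) (h₁.1.2.1.congr eg₁) hadm₁ h1]
      with z hz e0 e1
    exact ⟨hz, e0, e1⟩
  obtain ⟨hsX, hsY⟩ := hγ.support_subset_image hK (hconc hγ le_rfl)
  have hAK (i : I) : A i ⊆ Prod.fst '' K := ((subset_iUnion A i).trans hρA.ge).trans hsX
  have hBK (j : J) : B j ⊆ Prod.snd '' K := ((subset_iUnion B j).trans hμB.ge).trans hsY
  have hAconst (i : I) {x x' : E} (hx : x ∈ A i) (hx' : x' ∈ A i) :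
      f₁ x' - f₀ x' = f₁ x - f₀ x := by
    refine (hA i).sub_eq_sub ?_ hX hY hc hadm₀ hadm₁ ?_ hx hx'
    · intro x hx
      obtain ⟨z, hz, rfl⟩ := hAK i hx
      exact hz.1.1
    · intro x hx
      obtain ⟨z, hz, rfl⟩ := hAK i hx
      exact ⟨z.2, hz.1.2, hz.2⟩
  have hBconst (j : J) {y y' : F} (hy : y ∈ B j) (hy' : y' ∈ B j) :
      g₁ y' - g₀ y' = g₁ y - g₀ y := by
    have hc' : ContDiffOn ℝ 1 (c ∘ Prod.swap) (Y ×ˢ X) :=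
      hc.comp (contDiff_snd.prodMk contDiff_fst).contDiffOn fun z hz => ⟨hz.2, hz.1⟩
    refine (hB j).sub_eq_sub ?_ hY hX hc'
      (fun y hy x hx => (add_comm _ _).trans_le (hadm₀ x hx y hy))
      (fun y hy x hx => (add_comm _ _).trans_le (hadm₁ x hx y hy)) ?_ hy hy'
    · intro y hy
      obtain ⟨z, hz, rfl⟩ := hBK j hy
      exact hz.1.2
    · intro y hy
      obtain ⟨z, hz, rfl⟩ := hBK j hy
      exact ⟨z.1, hz.1.1, (add_comm _ _).trans hz.2.1, (add_comm _ _).trans hz.2.2⟩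
  have hedge {i : I} {j : J} (h : Charged c ρ μ (A i) (B j)) :
      ∃ x ∈ A i, ∃ y ∈ B j, f₁ x - f₀ x = -(g₁ y - g₀ y) := by
    obtain ⟨γ', ⟨hγ', hopt⟩, hpos⟩ := h
    have hKae := hconc hγ' (hopt γ hγ)
    obtain ⟨z, hz, hzK⟩ : ((A i ×ˢ B j) ∩ K).Nonempty := by
      by_contra hne
      -- This argument is valid for outer measure, so the rectangle need not be measurable.
      refine hpos.ne' (measure_eq_zero_iff_ae_notMem.2 ?_)
      filter_upwards [hKae] with z hzK hz
      exact hne ⟨z, hz, hzK⟩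
    exact ⟨z.1, hz.1, z.2, hz.2, by linarith [hzK.2.1, hzK.2.2]⟩
  obtain ⟨x₀, hx₀⟩ := Measure.nonempty_support (IsProbabilityMeasure.ne_zero ρ)
  obtain ⟨i₀, hi₀⟩ := mem_iUnion.1 (hρA ▸ hx₀)
  set a : ℝ := f₁ x₀ - f₀ x₀
  -- The sign flip on the B side makes one constant a serve all vertices, so P passes unchanged
  -- along edges.
  let P : I ⊕ J → Prop :=
    Sum.elim (fun i => ∀ x ∈ A i, f₁ x - f₀ x = a) (fun j => ∀ y ∈ B j, -(g₁ y - g₀ y) = a)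
  have hP (u : I ⊕ J) : P u := by
    have hr := hG.preconnected (Sum.inl i₀) u
    rw [SimpleGraph.reachable_iff_reflTransGen] at hr
    induction hr with
    | refl => exact fun x hx => hAconst i₀ hi₀ hx
    | tail _ hadj ih =>
      rcases hadj with ⟨i, j, rfl, rfl, h⟩ | ⟨i, j, rfl, rfl, h⟩
      · obtain ⟨x, hx, y, hy, e⟩ := hedge h
        intro y' hy'
        rw [hBconst j hy hy', ← e]
        exact ih x hx
      · obtain ⟨x, hx, y, hy, e⟩ := hedge h
        intro x' hx'
        rw [hAconst i hx hx', e]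
        exact ih y hy
  refine ⟨a, ?_, ?_⟩
  · filter_upwards [ef₀, ef₁, Measure.support_mem_ae (μ := ρ)] with x e0 e1 hx
    obtain ⟨i, hi⟩ := mem_iUnion.1 (hρA ▸ hx)
    have := hP (Sum.inl i) x hi
    linarith
  · filter_upwards [eg₀, eg₁, Measure.support_mem_ae (μ := μ)] with y e0 e1 hy
    obtain ⟨j, hj⟩ := mem_iUnion.1 (hμB ▸ hy)
    have := hP (Sum.inr j) y hj
    linarith

end Uniqueness

end OTUniqueness

theorem mainTheorem2 (d : ℕ)
    (X Y : Set (EuclideanSpace ℝ (Fin d))) (hX : IsCompact X) (hY : IsCompact Y)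
    (ρ μ : Measure (EuclideanSpace ℝ (Fin d))) [IsProbabilityMeasure ρ] [IsProbabilityMeasure μ]
    (hρX : ρ Xᶜ = 0) (hμY : μ Yᶜ = 0)
    (c : EuclideanSpace ℝ (Fin d) × EuclideanSpace ℝ (Fin d) → ℝ)
    (hc : ContDiffOn ℝ 1 c (X ×ˢ Y))
    {I J : Type*} [Finite I] [Finite J]
    (A : I → Set (EuclideanSpace ℝ (Fin d))) (B : J → Set (EuclideanSpace ℝ (Fin d)))
    (hA : ∀ i, OTUniqueness.LipschitzPathConnected (A i))
    (hB : ∀ j, OTUniqueness.LipschitzPathConnected (B j))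
    (hρA : ρ.support = ⋃ i, A i) (hμB : μ.support = ⋃ j, B j)
    (hG : (OTUniqueness.transportGraph c ρ μ A B).Connected)
    (φ₀ ψ₀ φ₁ ψ₁ : EuclideanSpace ℝ (Fin d) → ℝ)
    (h₀ : OTUniqueness.IsDualOptimiser X Y c ρ μ φ₀ ψ₀)
    (h₁ : OTUniqueness.IsDualOptimiser X Y c ρ μ φ₁ ψ₁) :
    ∃ a : ℝ, (∀ᵐ x ∂ρ, φ₁ x = φ₀ x + a) ∧ (∀ᵐ y ∂μ, ψ₁ y = ψ₀ y - a) :=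
  OTUniqueness.exists_ae_eq_add_of_connected hX hY hρX hμY hc hA hB hρA hμB hG h₀ h₁
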